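/- Let $\mathbb{T}^n$ carry normalized Lebesgue measure, let $H^2(\mathbb{D}^n)$ be the closure of the polynomials $\mathbb{C}[z_1,\dots,z_n]$ in $L^2(\mathbb{T}^n)$, and let $M_{z_i}$ be multiplication by the coordinate $z_i$ on $H^2(\mathbb{D}^n)$. A submodule is a closed subspace $\mathcal{S}\subseteq H^2(\mathbb{D}^n)$ with $M_{z_i}\mathcal{S}\subseteq\mathcal{S}$ for all $i$; put $R_{z_i}=M_{z_i}|_{\mathcal{S}}$, $\mathcal{Q}=\mathcal{S}^\perp$ and $C_{z_i}=P_{\mathcal{Q}}M_{z_i}|_{\mathcal{Q}}$. The submodule $\mathcal{S}$ is co-doubly commuting if $C_{z_i}C_{z_j}^*=C_{z_j}^*C_{z_i}$ for all $i<j$. It is essentially doubly commuting if $[R_{z_i}^*,R_{z_j}]=R_{z_i}^*R_{z_j}-R_{z_j}R_{z_i}^*$ is compact for all $i<j$, and essentially normal if it is compact for all $i,j$. An inner function is a bounded holomorphic function on $\mathbb{D}$ whose radial boundary values have modulus $1$ almost everywhere on $\mathbb{T}$. Let $n\ge 2$, let $\Theta_1,\dots,\Theta_n$ be inner functions on $\mathbb{D}$,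 put $\tilde\Theta_i(z_1,\dots,z_n)=\Theta_i(z_i)$, and let $$\mathcal{S}=\sum_{i=1}^n\tilde\Theta_i H^2(\mathbb{D}^n)$$ be a co-doubly commuting submodule of $H^2(\mathbb{D}^n)$ of infinite codimension, that is, $\dim H^2(\mathbb{D}^n)/\mathcal{S}=\infty$. If $\mathcal{S}$ is essentially doubly commuting, then $n=2$. In particular, if $\mathcal{S}$ is essentially normal, then $n=2$. -/

import Mathlib

open MeasureTheory Filter Topology
open scoped ENNReal

noncomputable section

namespace HardyPolydisc

/-! ### Hilbert modules over `ℂ[z₁, …, zₙ]`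

A Hilbert module is a Hilbert space with a tuple `T = (T₁, …, Tₙ)` of (commuting) bounded operators,
the module multiplications by the coordinate functions. -/

section HilbertModule

variable {n : ℕ} {H : Type*} [NormedAddCommGroup H] [InnerProductSpace ℂ H] [CompleteSpace H]

/-- The (cross) commutator `[A*, B] = A* B - B A*`. -/
def crossCommutator (A B : H →L[ℂ] H) : H →L[ℂ] H :=
  ContinuousLinearMap.adjoint A ∘L B - B ∘L ContinuousLinearMap.adjoint A

/-- `Tᵢ Tⱼ* = Tⱼ* Tᵢ` for all `i < j`. -/
def IsDoublyCommuting (T : Fin n → H →L[ℂ] H) : Prop :=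
  ∀ i j : Fin n, i < j →
    T i ∘L ContinuousLinearMap.adjoint (T j) = ContinuousLinearMap.adjoint (T j) ∘L T i

/-- `[Tᵢ*, Tⱼ]` is compact for all `i < j`. -/
def IsEssentiallyDoublyCommuting (T : Fin n → H →L[ℂ] H) : Prop :=
  ∀ i j : Fin n, i < j → IsCompactOperator (crossCommutator (T i) (T j))

/-- `[Tᵢ*, Tⱼ]` is compact for all `i, j`. -/
def IsEssentiallyNormal (T : Fin n → H →L[ℂ] H) : Prop :=
  ∀ i j : Fin n, IsCompactOperator (crossCommutator (T i) (T j))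

/-- A submodule of the Hilbert module `(H, T)`: a closed subspace invariant under every `Tᵢ`. -/
structure HilbertSubmodule (T : Fin n → H →L[ℂ] H) extends Submodule ℂ H where
  isClosed : IsClosed (toSubmodule : Set H)
  invariant : ∀ i : Fin n, ∀ x ∈ toSubmodule, T i x ∈ toSubmodule

variable {T : Fin n → H →L[ℂ] H}

instance (S : HilbertSubmodule T) : CompleteSpace S.toSubmodule :=
  S.isClosed.completeSpace_coe

/-- The module multiplications `Rᵢ = Tᵢ|_S` of a submodule `S`. -/
def HilbertSubmodule.restriction (S : HilbertSubmodule T) (i : Fin n) :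
    S.toSubmodule →L[ℂ] S.toSubmodule :=
  (T i ∘L S.toSubmodule.subtypeL).codRestrict S.toSubmodule fun x => S.invariant i x x.2

/-- The module multiplications `Cᵢ = P_Q Tᵢ|_Q` of the quotient module `Q = Sᗮ ≅ H / S`. -/
def HilbertSubmodule.compression (S : HilbertSubmodule T) (i : Fin n) :
    (S.toSubmoduleᗮ : Submodule ℂ H) →L[ℂ] (S.toSubmoduleᗮ : Submodule ℂ H) :=
  (S.toSubmoduleᗮ).orthogonalProjectionOnto ∘L T i ∘L (S.toSubmoduleᗮ).subtypeL

/-- The submodule `S`, as a Hilbert module, is essentially doubly commuting. -/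
def HilbertSubmodule.IsEssentiallyDoublyCommuting (S : HilbertSubmodule T) : Prop :=
  HardyPolydisc.IsEssentiallyDoublyCommuting (H := S.toSubmodule) S.restriction

/-- The submodule `S`, as a Hilbert module, is essentially normal. -/
def HilbertSubmodule.IsEssentiallyNormal (S : HilbertSubmodule T) : Prop :=
  HardyPolydisc.IsEssentiallyNormal (H := S.toSubmodule) S.restriction

/-- `S` is co-doubly commuting if its quotient module is doubly commuting. -/
def HilbertSubmodule.IsCoDoublyCommuting (S : HilbertSubmodule T) : Prop :=
  HardyPolydisc.IsDoublyCommuting (H := (S.toSubmoduleᗮ : Submodule ℂ H)) S.compression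

end HilbertModule

/-! ### The Hardy module over the polydisc

The torus `𝕋ⁿ` is `UnitAddTorus (Fin n) = (ℝ/ℤ)ⁿ`, where the class `x` stands for the point with
coordinates `e^{2πi xⱼ}`. -/

/-- Normalized Haar (Lebesgue) measure on `𝕋ⁿ`. -/
abbrev torusMeasure (n : ℕ) : Measure (UnitAddTorus (Fin n)) :=
  Measure.pi fun _ => AddCircle.haarAddCircle

/-- `L²(𝕋ⁿ)`. -/
abbrev L2Torus (n : ℕ) : Type := Lp ℂ 2 (torusMeasure n)

/-- The monomial `z₁^{k₁} ⋯ zₙ^{kₙ}` in `L²(𝕋ⁿ)`. -/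
def monomialL2 {n : ℕ} (k : Fin n → ℕ) : L2Torus n :=
  ContinuousMap.toLp 2 (torusMeasure n) ℂ (UnitAddTorus.mFourier fun i => (k i : ℤ))

/-- `H²(𝔻ⁿ)`, the closure of the polynomials in `L²(𝕋ⁿ)`, as a subspace of `L²(𝕋ⁿ)`. -/
def hardySpace (n : ℕ) : Submodule ℂ (L2Torus n) :=
  (Submodule.span ℂ (Set.range (monomialL2 (n := n)))).topologicalClosure

/-- `H²(𝔻ⁿ)` as a Hilbert space. -/
abbrev H2 (n : ℕ) : Type := hardySpace n

instance (n : ℕ) : CompleteSpace (H2 n) :=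
  Submodule.topologicalClosure.completeSpace _

/-- Multiplication by the coordinate `zᵢ` on `L²(𝕋ⁿ)`. -/
def coordMulL2 {n : ℕ} (i : Fin n) : L2Torus n →L[ℂ] L2Torus n :=
  (ContinuousLinearMap.mul ℂ ℂ).holderL (torusMeasure n) ∞ 2 2
    (ContinuousMap.toLp ∞ (torusMeasure n) ℂ (UnitAddTorus.mFourier (Pi.single i 1)))

theorem coordMulL2_ae {n : ℕ} (i : Fin n) (f : L2Torus n) :
    coordMulL2 i f =ᵐ[torusMeasure n]
      fun x => (AddCircle.toCircle (x i) : ℂ) * f x := by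
  have h1 : coordMulL2 i f =ᵐ[torusMeasure n] fun x =>
      (ContinuousMap.toLp (E := ℂ) ∞ (torusMeasure n) ℂ
        (UnitAddTorus.mFourier (Pi.single i 1))) x * f x :=
    ContinuousLinearMap.coeFn_holder _ _ _
  filter_upwards [h1, ContinuousMap.coeFn_toLp (p := ∞) (𝕜 := ℂ) (torusMeasure n)
    (UnitAddTorus.mFourier (Pi.single i 1))] with x hx hx'
  rw [hx, hx', UnitAddTorus.mFourier_single, fourier_one]

theorem coordMulL2_monomial {n : ℕ} (i : Fin n) (k : Fin n → ℕ) :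
    coordMulL2 i (monomialL2 k) = monomialL2 (k + Pi.single i 1) := by
  apply Lp.ext
  filter_upwards [coordMulL2_ae i (monomialL2 k),
    ContinuousMap.coeFn_toLp (p := 2) (𝕜 := ℂ) (torusMeasure n)
      (UnitAddTorus.mFourier fun j => (k j : ℤ)),
    ContinuousMap.coeFn_toLp (p := 2) (𝕜 := ℂ) (torusMeasure n)
      (UnitAddTorus.mFourier fun j => ((k + Pi.single i 1 : Fin n → ℕ) j : ℤ))] with x h1 h2 h3
  have e : (fun j => ((k + Pi.single i 1 : Fin n → ℕ) j : ℤ))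
      = Pi.single i 1 + fun j => (k j : ℤ) := by
    ext j
    by_cases h : j = i
    · subst h; simp [add_comm]
    · simp [h]
  rw [h1]
  unfold monomialL2
  rw [h2, h3, e, UnitAddTorus.mFourier_add, UnitAddTorus.mFourier_single, fourier_one]

theorem coordMulL2_mem {n : ℕ} (i : Fin n) (f : L2Torus n) (hf : f ∈ hardySpace n) :
    coordMulL2 i f ∈ hardySpace n := by
  have h : Set.MapsTo (coordMulL2 i)
      (Submodule.span ℂ (Set.range (monomialL2 (n := n))) : Set (L2Torus n))
      (Submodule.span ℂ (Set.range (monomialL2 (n := n)))) := by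
    intro g hg
    induction hg using Submodule.span_induction with
    | mem g hg =>
      obtain ⟨k, rfl⟩ := hg
      rw [coordMulL2_monomial]
      exact Submodule.subset_span ⟨_, rfl⟩
    | zero => simp
    | add g g' _ _ h h' => rw [map_add]; exact Submodule.add_mem _ h h'
    | smul c g _ h => rw [map_smul]; exact Submodule.smul_mem _ c h
  exact h.closure (coordMulL2 i).continuous hf

/-- The module multiplications `M_{z₁}, …, M_{zₙ}` on the Hardy module `H²(𝔻ⁿ)`. -/
def coordMul (n : ℕ) (i : Fin n) : H2 n →L[ℂ] H2 n :=
  (coordMulL2 i ∘L (hardySpace n).subtypeL).codRestrict (hardySpace n)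
    fun f => coordMulL2_mem i f f.2

/-- The radial boundary value `lim_{r → 1⁻} F(r e^{2πi x₁}, …, r e^{2πi xₙ})` of a function `F` on
`𝔻ⁿ` (it is only used for `F` for which this limit exists almost everywhere). -/
def boundaryValue {n : ℕ} (F : (Fin n → ℂ) → ℂ) (x : UnitAddTorus (Fin n)) : ℂ :=
  limUnder (𝓝[<] (1 : ℝ)) fun r => F fun i => (r : ℂ) * (AddCircle.toCircle (x i) : ℂ)

/-- `F H²(𝔻ⁿ)`: the functions in `H²(𝔻ⁿ)` of the form `F g` with `g ∈ H²(𝔻ⁿ)`. -/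
def multiplierRange {n : ℕ} (F : (Fin n → ℂ) → ℂ) : Submodule ℂ (H2 n) where
  carrier := {f | ∃ g : H2 n, (f : L2Torus n) =ᵐ[torusMeasure n]
    fun x => boundaryValue F x * (g : L2Torus n) x}
  zero_mem' := by
    refine ⟨0, ?_⟩
    filter_upwards [Lp.coeFn_zero ℂ 2 (torusMeasure n)] with x hx
    rw [ZeroMemClass.coe_zero, hx, Pi.zero_apply, mul_zero]
  add_mem' := by
    rintro f₁ f₂ ⟨g₁, h₁⟩ ⟨g₂, h₂⟩
    refine ⟨g₁ + g₂, ?_⟩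
    filter_upwards [h₁, h₂, Lp.coeFn_add (f₁ : L2Torus n) (f₂ : L2Torus n),
      Lp.coeFn_add (g₁ : L2Torus n) (g₂ : L2Torus n)] with x a₁ a₂ b c
    simp only [Submodule.coe_add, b, c, Pi.add_apply, a₁, a₂, mul_add]
  smul_mem' := by
    rintro a f ⟨g, h⟩
    refine ⟨a • g, ?_⟩
    filter_upwards [h, Lp.coeFn_smul a (f : L2Torus n), Lp.coeFn_smul a (g : L2Torus n)]
      with x h b c
    simp only [Submodule.coe_smul, b, c, Pi.smul_apply, h, smul_eq_mul]
    ring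

/-- One-variable inner functions: bounded holomorphic functions on `𝔻` whose radial boundary values
exist and have modulus one almost everywhere on the circle. -/
structure IsInner (θ : ℂ → ℂ) : Prop where
  differentiableOn : DifferentiableOn ℂ θ (Metric.ball 0 1)
  bounded : ∃ C : ℝ, ∀ z ∈ Metric.ball (0 : ℂ) 1, ‖θ z‖ ≤ C
  unimodular : ∀ᵐ x : UnitAddCircle ∂AddCircle.haarAddCircle, ∃ w : ℂ, ‖w‖ = 1 ∧
    Tendsto (fun r : ℝ => θ ((r : ℂ) * (AddCircle.toCircle x : ℂ))) (𝓝[<] (1 : ℝ)) (𝓝 w)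

end HardyPolydisc

end

/-! Suppose `n ≥ 3`. If some `Θ_l` has constant boundary values, then `S` is everything, so each
backward shift `B_l = (Θ_l - Θ_l(0)) / z` may be taken nonzero. The claim is then that every model
space `H² ⊖ Θ_k H²` is finite-dimensional. Since `Sᗮ` is spanned by products of model functions in
the separate variables, `S` then has finite codimension, a contradiction.

Fix `k` and choose `i < j` different from `k`; this is where a third variable is needed. For `q`,
`r` in the `k`-th model space let `Jq` be the elementary tensor with factor `Θ_i` in the variable
`i`, `q` in the variable `k` and `B_l` in every other variable; `Gr` is built likewise from `Θ_j`
and `r`. Both lie in `S`. Moreover `Jq` is orthogonal to `z_i S`, so `R_i* Jq = 0` and `⟨[R_i*, R_j]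
Jq, Gr⟩ = ⟨z_j Jq, z_i Gr⟩`.

This inner product factors over the variables. Because `z B_l = Θ_l - Θ_l(0)` and `⟨Θ_l, Θ_l -
Θ_l(0)⟩ = ‖B_l‖²`, it equals `⟨q, r⟩ ∏_{l ≠ k} ‖B_l‖²`. A compact cross commutator thus compresses
to a nonzero multiple of the identity of the model space, which must be finite-dimensional by Riesz.
The argument is carried by `inner_testMap_coordMul`, `exists_inner_coordMul_testMap`,
`finiteDimensional_of_isCompactOperator` and `finiteDimensional_quotient`. -/

noncomputable section

namespace HardyPolydisc

open ComplexConjugate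

/-! ### Multiplication by unimodular functions -/

section Unimodular

variable {X : Type*} [MeasurableSpace X] {μ : Measure X}

/-- Almost everywhere strongly measurable functions of modulus one almost everywhere. -/
structure IsUnimodular (u : X → ℂ) (μ : Measure X) : Prop where
  aestronglyMeasurable : AEStronglyMeasurable u μ
  norm_eq_one : ∀ᵐ x ∂μ, ‖u x‖ = 1

theorem IsUnimodular.memLp_mul {u : X → ℂ} (hu : IsUnimodular u μ) (f : Lp ℂ 2 μ) :
    MemLp (fun x => u x * f x) 2 μ := by
  refine (Lp.memLp f).congr_norm (hu.aestronglyMeasurable.mul (Lp.aestronglyMeasurable f)) ?_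
  filter_upwards [hu.norm_eq_one] with x hx
  rw [norm_mul, hx, one_mul]

/-- Multiplication by a unimodular function, as an isometry of `L²`. -/
def unimodularMul {u : X → ℂ} (hu : IsUnimodular u μ) : Lp ℂ 2 μ →ₗᵢ[ℂ] Lp ℂ 2 μ where
  toFun f := (hu.memLp_mul f).toLp _
  map_add' f g := by
    rw [← MemLp.toLp_add]
    apply MemLp.toLp_congr
    filter_upwards [Lp.coeFn_add f g] with x hx
    simp only [hx, Pi.add_apply, mul_add]
  map_smul' c f := by
    rw [RingHom.id_apply, ← MemLp.toLp_const_smul]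
    apply MemLp.toLp_congr
    filter_upwards [Lp.coeFn_smul c f] with x hx
    simp only [hx, Pi.smul_apply, smul_eq_mul]
    ring
  norm_map' f := by
    simp only [LinearMap.coe_mk, AddHom.coe_mk]
    rw [Lp.norm_toLp, Lp.norm_def]
    congr 1
    apply eLpNorm_congr_norm_ae
    filter_upwards [hu.norm_eq_one] with x hx
    rw [norm_mul, hx, one_mul]

theorem unimodularMul_ae {u : X → ℂ} (hu : IsUnimodular u μ) (f : Lp ℂ 2 μ) :
    unimodularMul hu f =ᵐ[μ] fun x => u x * f x :=
  MemLp.coeFn_toLp (hu.memLp_mul f)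

theorem eq_unimodularMul_iff {u : X → ℂ} (hu : IsUnimodular u μ) (f g : Lp ℂ 2 μ) :
    f = unimodularMul hu g ↔ f =ᵐ[μ] fun x => u x * g x := by
  constructor
  · rintro rfl
    exact unimodularMul_ae hu g
  · intro h
    exact Lp.ext (h.trans (unimodularMul_ae hu g).symm)

theorem unimodularMul_comm {u v : X → ℂ} (hu : IsUnimodular u μ) (hv : IsUnimodular v μ)
    (f : Lp ℂ 2 μ) :
    unimodularMul hu (unimodularMul hv f) = unimodularMul hv (unimodularMul hu f) := by
  apply Lp.ext
  filter_upwards [unimodularMul_ae hu (unimodularMul hv f), unimodularMul_ae hv f,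
    unimodularMul_ae hv (unimodularMul hu f), unimodularMul_ae hu f] with x h1 h2 h3 h4
  rw [h1, h2, h3, h4]
  ring

end Unimodular

/-- A vector is in the closed span of a part of a Hilbert basis if its other coordinates vanish. -/
theorem mem_closure_span_of_inner_eq_zero {ι E : Type*} [NormedAddCommGroup E]
    [InnerProductSpace ℂ E] (b : HilbertBasis ι ℂ E) (s : Set ι) (x : E)
    (hx : ∀ i ∉ s, inner ℂ (b i) x = 0) :
    x ∈ (Submodule.span ℂ (b '' s)).topologicalClosure := by
  have h := b.hasSum_repr x
  refine (Submodule.isClosed_topologicalClosure _).mem_of_tendsto h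
    (Eventually.of_forall fun t => Submodule.sum_mem _ fun i _ => ?_)
  by_cases hi : i ∈ s
  · exact Submodule.smul_mem _ _
      (Submodule.le_topologicalClosure _ (Submodule.subset_span ⟨i, hi, rfl⟩))
  · rw [b.repr_apply_apply, hx i hi, zero_smul]
    exact Submodule.zero_mem _

/-! ### The Hardy space of the circle -/

/-- `L²(𝕋)`. -/
abbrev L2Circle : Type := Lp ℂ 2 (AddCircle.haarAddCircle : Measure UnitAddCircle)

/-- The monomial `zᵏ`, `k ∈ ℤ`, in `L²(𝕋)`. -/
def circleMonomial (k : ℤ) : L2Circle := fourierLp 2 k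

theorem circleMonomial_ae (k : ℤ) :
    circleMonomial k =ᵐ[AddCircle.haarAddCircle] fun x => fourier k x :=
  coeFn_fourierLp 2 k

theorem inner_circleMonomial (k l : ℤ) :
    inner ℂ (circleMonomial k) (circleMonomial l) = if k = l then 1 else 0 :=
  orthonormal_iff_ite.mp orthonormal_fourier k l

/-- `H²(𝔻)` as a subspace of `L²(𝕋)`. -/
def hardyCircle : Submodule ℂ L2Circle :=
  (Submodule.span ℂ (Set.range fun k : ℕ => circleMonomial k)).topologicalClosure

theorem isClosed_hardyCircle : IsClosed (hardyCircle : Set L2Circle) :=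
  Submodule.isClosed_topologicalClosure _

theorem circleMonomial_mem_hardyCircle (k : ℕ) : circleMonomial k ∈ hardyCircle :=
  Submodule.le_topologicalClosure _ (Submodule.subset_span ⟨k, rfl⟩)

theorem hardyCircle_le {F : Submodule ℂ L2Circle} (hF : IsClosed (F : Set L2Circle))
    (h : ∀ k : ℕ, circleMonomial k ∈ F) : hardyCircle ≤ F :=
  Submodule.topologicalClosure_minimal _
    (Submodule.span_le.2 (by rintro _ ⟨k, rfl⟩; exact h k)) hF

theorem mem_hardyCircle_of_inner_eq_zero (f : L2Circle)
    (hf : ∀ k : ℤ, k < 0 → inner ℂ (circleMonomial k) f = 0) : f ∈ hardyCircle := by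
  have h := mem_closure_span_of_inner_eq_zero (fourierBasis (T := 1)) {k | 0 ≤ k} f
    (fun k hk => by
      rw [coe_fourierBasis]
      exact hf k (not_le.1 hk))
  refine Submodule.topologicalClosure_mono (Submodule.span_mono ?_) h
  rintro _ ⟨k, hk, rfl⟩
  rw [coe_fourierBasis]
  exact ⟨k.toNat, by simp only [Int.toNat_of_nonneg hk]; rfl⟩

theorem inner_circleMonomial_of_mem_hardyCircle {f : L2Circle} (hf : f ∈ hardyCircle) {k : ℤ}
    (hk : k < 0) : inner ℂ (circleMonomial k) f = 0 := by
  have : hardyCircle ≤ (ℂ ∙ circleMonomial k)ᗮ := by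
    refine hardyCircle_le (Submodule.isClosed_orthogonal _) fun l => ?_
    rw [Submodule.mem_orthogonal_singleton_iff_inner_right, inner_circleMonomial, if_neg (by lia)]
  exact (Submodule.mem_orthogonal_singleton_iff_inner_right).1 (this hf)

theorem isUnimodular_fourier (k : ℤ) :
    IsUnimodular (fun x : UnitAddCircle => fourier k x) AddCircle.haarAddCircle where
  aestronglyMeasurable := (fourier k).continuous.aestronglyMeasurable
  norm_eq_one := ae_of_all _ fun x => by rw [fourier_apply, Circle.norm_coe]

/-- Multiplication by `zᵏ` on `L²(𝕋)`. -/
def circleShift (k : ℤ) : L2Circle →ₗᵢ[ℂ] L2Circle := unimodularMul (isUnimodular_fourier k)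

theorem circleShift_circleMonomial (k l : ℤ) :
    circleShift k (circleMonomial l) = circleMonomial (k + l) := by
  symm
  rw [circleShift, eq_unimodularMul_iff]
  filter_upwards [circleMonomial_ae l, circleMonomial_ae (k + l)] with x h1 h2
  rw [h1, h2, fourier_add]

theorem circleShift_circleShift (k l : ℤ) (f : L2Circle) :
    circleShift k (circleShift l f) = circleShift (k + l) f := by
  conv_lhs => rw [circleShift]
  symm
  rw [eq_unimodularMul_iff]
  filter_upwards [unimodularMul_ae (isUnimodular_fourier (k + l)) f,
    unimodularMul_ae (isUnimodular_fourier l) f] with x h1 h2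
  rw [circleShift, circleShift, h1, h2, fourier_add, mul_assoc]

theorem circleShift_zero (f : L2Circle) : circleShift 0 f = f := by
  symm
  rw [circleShift, eq_unimodularMul_iff]
  exact ae_of_all _ fun x => by simp

theorem inner_circleShift_left (k : ℤ) (f g : L2Circle) :
    inner ℂ (circleShift k f) g = inner ℂ f (circleShift (-k) g) := by
  rw [← (circleShift (-k)).inner_map_map (circleShift k f) g, circleShift_circleShift,
    neg_add_cancel, circleShift_zero]

/-! ### Boundary values of inner functions -/

/-- The radial boundary value of a function on the disc. -/
def radialLimit (θ : ℂ → ℂ) (x : UnitAddCircle) : ℂ :=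
  limUnder (𝓝[<] (1 : ℝ)) fun r => θ ((r : ℂ) * (AddCircle.toCircle x : ℂ))

theorem IsInner.tendsto_radialLimit {θ : ℂ → ℂ} (hθ : IsInner θ) :
    ∀ᵐ x : UnitAddCircle ∂AddCircle.haarAddCircle, ‖radialLimit θ x‖ = 1 ∧
      Tendsto (fun r : ℝ => θ ((r : ℂ) * (AddCircle.toCircle x : ℂ))) (𝓝[<] (1 : ℝ))
        (𝓝 (radialLimit θ x)) := by
  filter_upwards [hθ.unimodular] with x hx
  obtain ⟨w, hw, h⟩ := hx
  have : radialLimit θ x = w := h.limUnder_eq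
  rw [this]
  exact ⟨hw, h⟩

theorem mul_toCircle_mem_ball {r : ℝ} (h0 : 0 ≤ r) (h1 : r < 1) (x : UnitAddCircle) :
    (r : ℂ) * (AddCircle.toCircle x : ℂ) ∈ Metric.ball (0 : ℂ) 1 := by
  rw [mem_ball_zero_iff, norm_mul, Circle.norm_coe, mul_one, Complex.norm_real,
    Real.norm_of_nonneg h0]
  exact h1

theorem IsInner.continuous_dilation {θ : ℂ → ℂ} (hθ : IsInner θ) {r : ℝ} (h0 : 0 ≤ r)
    (h1 : r < 1) :
    Continuous fun x : UnitAddCircle => θ ((r : ℂ) * (AddCircle.toCircle x : ℂ)) := by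
  refine hθ.differentiableOn.continuousOn.comp_continuous ?_ fun x => mul_toCircle_mem_ball h0 h1 x
  have := AddCircle.continuous_toCircle (T := 1)
  fun_prop

/-- Radii increasing to one. -/
def radius (m : ℕ) : ℝ := 1 - 1 / ((m : ℝ) + 2)

theorem radius_pos (m : ℕ) : 0 < radius m := by
  have : 1 / ((m : ℝ) + 2) < 1 := by
    rw [div_lt_one (by positivity)]
    linarith [(Nat.cast_nonneg m : (0 : ℝ) ≤ m)]
  unfold radius
  linarith

theorem radius_lt_one (m : ℕ) : radius m < 1 := by
  have : 0 < 1 / ((m : ℝ) + 2) := by positivity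
  unfold radius
  linarith

theorem tendsto_radius : Tendsto radius atTop (𝓝[<] (1 : ℝ)) := by
  refine tendsto_nhdsWithin_iff.2 ⟨?_, Eventually.of_forall radius_lt_one⟩
  have h : Tendsto (fun m : ℕ => (m : ℝ) + 2) atTop atTop :=
    tendsto_atTop_add_const_right _ _ tendsto_natCast_atTop_atTop
  have := h.inv_tendsto_atTop.const_sub 1
  rw [sub_zero] at this
  refine this.congr fun m => ?_
  rw [radius, one_div, Pi.inv_apply]

theorem IsInner.isUnimodular {θ : ℂ → ℂ} (hθ : IsInner θ) :
    IsUnimodular (radialLimit θ) AddCircle.haarAddCircle where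
  aestronglyMeasurable := by
    -- The radial limit is taken along a sequence of radii, so it is an almost everywhere limit of
    -- countably many continuous functions.
    refine aestronglyMeasurable_of_tendsto_ae atTop
      (f := fun m x => θ ((radius m : ℂ) * (AddCircle.toCircle x : ℂ)))
      (fun m => (hθ.continuous_dilation (radius_pos m).le
        (radius_lt_one m)).aestronglyMeasurable) ?_
    filter_upwards [hθ.tendsto_radialLimit] with x hx
    exact hx.2.comp tendsto_radius
  norm_eq_one := hθ.tendsto_radialLimit.mono fun _ h => h.1

/-- Cauchy's theorem on the circle of radius `r < 1`. -/
theorem integral_fourier_mul_dilation {θ : ℂ → ℂ} (hθ : DifferentiableOn ℂ θ (Metric.ball 0 1))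
    {r : ℝ} (h0 : 0 < r) (h1 : r < 1) (k : ℕ) :
    ∫ x : UnitAddCircle, fourier ((k : ℤ) + 1) x * θ ((r : ℂ) * (AddCircle.toCircle x : ℂ))
      ∂AddCircle.haarAddCircle = 0 := by
  have hc : (∮ z in C(0, r), z ^ k * θ z) = 0 := by
    have hd : DifferentiableOn ℂ (fun z => z ^ k * θ z) (Metric.ball 0 1) := by fun_prop
    refine Complex.circleIntegral_eq_zero_of_differentiable_on_off_countable h0.le
      Set.countable_empty (hd.continuousOn.mono (Metric.closedBall_subset_ball h1)) ?_
    intro z hz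
    exact hd.differentiableAt (Metric.isOpen_ball.mem_nhds
      (Metric.ball_subset_ball h1.le hz.1))
  rw [AddCircle.integral_haarAddCircle, ← UnitAddCircle.intervalIntegral_preimage 0]
  rw [circleIntegral] at hc
  have h2 := intervalIntegral.integral_comp_mul_left (a := 0) (b := 1) (c := 2 * Real.pi)
    (fun s => deriv (circleMap 0 r) s • (circleMap 0 r s ^ k * θ (circleMap 0 r s)))
    (by positivity)
  rw [mul_zero, mul_one, hc, smul_zero] at h2
  -- On the circle `dz = i z ds`, which raises the exponent from `k` to `k + 1` and leaves the
  -- nonzero constant `r^(k+1) i`.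
  have h3 : ∀ t : ℝ, deriv (circleMap 0 r) (2 * Real.pi * t) •
      (circleMap 0 r (2 * Real.pi * t) ^ k * θ (circleMap 0 r (2 * Real.pi * t))) =
      ((r : ℂ) ^ (k + 1) * Complex.I) * (fourier ((k : ℤ) + 1) (t : UnitAddCircle) *
        θ ((r : ℂ) * (AddCircle.toCircle (t : UnitAddCircle) : ℂ))) := by
    intro t
    have e : circleMap 0 r (2 * Real.pi * t) =
        (r : ℂ) * (AddCircle.toCircle (t : UnitAddCircle) : ℂ) := by
      rw [AddCircle.toCircle_apply_mk, Circle.coe_exp, circleMap]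
      simp
    have e' : (fourier ((k : ℤ) + 1) (t : UnitAddCircle) : ℂ) =
        (AddCircle.toCircle (t : UnitAddCircle) : ℂ) ^ (k + 1) := by
      rw [fourier_apply, AddCircle.toCircle_zsmul]
      norm_cast
    rw [deriv_circleMap, e, e', smul_eq_mul]
    ring
  simp only [h3, intervalIntegral.integral_const_mul] at h2
  have h4 : (r : ℂ) ^ (k + 1) * Complex.I ≠ 0 :=
    mul_ne_zero (pow_ne_zero _ (by exact_mod_cast h0.ne')) Complex.I_ne_zero
  have h5 := (mul_eq_zero.1 h2).resolve_left h4
  rw [zero_add, h5, smul_zero]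

/-- The boundary function of an inner function, in `L²(𝕋)`. -/
def IsInner.boundary {θ : ℂ → ℂ} (hθ : IsInner θ) : L2Circle :=
  unimodularMul hθ.isUnimodular (circleMonomial 0)

/-- Negative Fourier coefficients of the dilations `θ(r ·)` vanish by Cauchy's theorem. Boundedness
of `θ` lets `r → 1` under the integral by dominated convergence. -/
theorem IsInner.inner_boundary {θ : ℂ → ℂ} (hθ : IsInner θ) (k : ℤ) (hk : k < 0) :
    inner ℂ (circleMonomial k) hθ.boundary = 0 := by
  obtain ⟨m, rfl⟩ : ∃ m : ℕ, k = -((m : ℤ) + 1) := ⟨(-k - 1).toNat, by lia⟩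
  have h1 : inner ℂ (circleMonomial (-((m : ℤ) + 1))) hθ.boundary =
      ∫ x : UnitAddCircle, fourier ((m : ℤ) + 1) x * radialLimit θ x
        ∂AddCircle.haarAddCircle := by
    rw [L2.inner_def]
    apply integral_congr_ae
    filter_upwards [circleMonomial_ae (-((m : ℤ) + 1)), circleMonomial_ae 0,
      unimodularMul_ae hθ.isUnimodular (circleMonomial 0)] with x a b c
    rw [RCLike.inner_apply, a, IsInner.boundary, c, b, fourier_zero, mul_one, fourier_neg,
      Complex.conj_conj, mul_comm]
  rw [h1]
  obtain ⟨C, hC⟩ := hθ.bounded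
  refine tendsto_nhds_unique (f := fun p : ℕ => ∫ x : UnitAddCircle, fourier ((m : ℤ) + 1) x *
    θ ((radius p : ℂ) * (AddCircle.toCircle x : ℂ)) ∂AddCircle.haarAddCircle) (l := atTop) ?_ ?_
  · refine tendsto_integral_of_dominated_convergence (fun _ => C) ?_ (integrable_const _) ?_ ?_
    · intro p
      exact ((fourier _).continuous.mul (hθ.continuous_dilation (radius_pos p).le
        (radius_lt_one p))).aestronglyMeasurable
    · intro p
      refine ae_of_all _ fun x => ?_
      rw [norm_mul, fourier_apply, Circle.norm_coe, one_mul]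
      exact hC _ (mul_toCircle_mem_ball (radius_pos p).le (radius_lt_one p) x)
    · filter_upwards [hθ.tendsto_radialLimit] with x hx
      exact (hx.2.comp tendsto_radius).const_mul _
  · simp only [integral_fourier_mul_dilation hθ.differentiableOn (radius_pos _)
      (radius_lt_one _)]
    exact tendsto_const_nhds

/-! ### Elementary tensors in `L²(𝕋ⁿ)` -/

section Tensor

variable {n : ℕ}

theorem quasiMeasurePreserving_coord (l : Fin n) :
    Measure.QuasiMeasurePreserving (fun x : UnitAddTorus (Fin n) => x l) (torusMeasure n)
      AddCircle.haarAddCircle :=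
  Measure.quasiMeasurePreserving_eval (fun _ => AddCircle.haarAddCircle) l

theorem IsUnimodular.coord {u : UnitAddCircle → ℂ}
    (hu : IsUnimodular u AddCircle.haarAddCircle) (l : Fin n) :
    IsUnimodular (fun x : UnitAddTorus (Fin n) => u (x l)) (torusMeasure n) where
  aestronglyMeasurable :=
    hu.aestronglyMeasurable.comp_quasiMeasurePreserving (quasiMeasurePreserving_coord l)
  norm_eq_one := (quasiMeasurePreserving_coord l).ae hu.norm_eq_one

theorem memLp_tensor (f : Fin n → L2Circle) :
    MemLp (fun x : UnitAddTorus (Fin n) => ∏ l, f l (x l)) 2 (torusMeasure n) := by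
  have hm : AEStronglyMeasurable (fun x : UnitAddTorus (Fin n) => ∏ l, f l (x l))
      (torusMeasure n) := by
    refine Finset.aestronglyMeasurable_fun_prod _ fun l _ => ?_
    exact (Lp.aestronglyMeasurable (f l)).comp_quasiMeasurePreserving
      (quasiMeasurePreserving_coord l)
  rw [memLp_two_iff_integrable_sq_norm hm]
  simp only [norm_prod, ← Finset.prod_pow]
  exact Integrable.fintype_prod (f := fun l y => ‖f l y‖ ^ 2)
    fun l => (memLp_two_iff_integrable_sq_norm (Lp.aestronglyMeasurable _)).1 (Lp.memLp (f l))

theorem prod_update_apply [DecidableEq (Fin n)] (f : Fin n → L2Circle) (l : Fin n)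
    (g : L2Circle) (x : UnitAddTorus (Fin n)) :
    ∏ m, (Function.update f l g) m (x m) =
      g (x l) * ∏ m ∈ Finset.univ.erase l, f m (x m) := by
  rw [← Finset.mul_prod_erase _ _ (Finset.mem_univ l), Function.update_self]
  congr 1
  refine Finset.prod_congr rfl fun m hm => ?_
  rw [Function.update_of_ne (Finset.ne_of_mem_erase hm)]

/-- The elementary tensor `f₁(z₁) ⋯ fₙ(zₙ)`. -/
def tensor (n : ℕ) : MultilinearMap ℂ (fun _ : Fin n => L2Circle) (L2Torus n) where
  toFun f := (memLp_tensor f).toLp _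
  map_update_add' f l g h := by
    rw [← MemLp.toLp_add]
    apply MemLp.toLp_congr
    filter_upwards [(quasiMeasurePreserving_coord l).ae (Lp.coeFn_add g h)] with x hx
    simp only [Pi.add_apply, prod_update_apply, hx, add_mul]
  map_update_smul' f l c g := by
    rw [← MemLp.toLp_const_smul]
    apply MemLp.toLp_congr
    filter_upwards [(quasiMeasurePreserving_coord l).ae (Lp.coeFn_smul c g)] with x hx
    simp only [Pi.smul_apply, prod_update_apply, hx, smul_eq_mul, mul_assoc]

theorem tensor_ae (f : Fin n → L2Circle) :
    tensor n f =ᵐ[torusMeasure n] fun x => ∏ l, f l (x l) :=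
  MemLp.coeFn_toLp (memLp_tensor f)

theorem eq_tensor_iff (F : L2Torus n) (f : Fin n → L2Circle) :
    F = tensor n f ↔ F =ᵐ[torusMeasure n] fun x => ∏ l, f l (x l) := by
  constructor
  · rintro rfl
    exact tensor_ae f
  · intro h
    exact Lp.ext (h.trans (tensor_ae f).symm)

theorem inner_tensor (f g : Fin n → L2Circle) :
    inner ℂ (tensor n f) (tensor n g) = ∏ l, inner ℂ (f l) (g l) := by
  simp only [L2.inner_def]
  rw [← integral_fintype_prod_eq_prod]
  apply integral_congr_ae
  filter_upwards [tensor_ae f, tensor_ae g] with x hf hg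
  simp only [hf, hg, RCLike.inner_apply, map_prod, Finset.prod_mul_distrib]

theorem norm_tensor (f : Fin n → L2Circle) : ‖tensor n f‖ = ∏ l, ‖f l‖ := by
  have h := inner_tensor f f
  simp only [inner_self_eq_norm_sq_to_K] at h
  have h' : ‖tensor n f‖ ^ 2 = (∏ l, ‖f l‖) ^ 2 := by
    rw [Finset.prod_pow] at h
    exact_mod_cast h
  exact (pow_left_inj₀ (norm_nonneg _) (Finset.prod_nonneg fun _ _ => norm_nonneg _)
    two_ne_zero).1 h'

theorem inner_tensor_eq_zero (f g : Fin n → L2Circle) (l : Fin n)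
    (h : inner ℂ (f l) (g l) = 0) : inner ℂ (tensor n f) (tensor n g) = 0 := by
  rw [inner_tensor]
  exact Finset.prod_eq_zero (Finset.mem_univ l) h

theorem unimodularMul_tensor {u : UnitAddCircle → ℂ}
    (hu : IsUnimodular u AddCircle.haarAddCircle) (l : Fin n) (f : Fin n → L2Circle) :
    unimodularMul (hu.coord l) (tensor n f) =
      tensor n (Function.update f l (unimodularMul hu (f l))) := by
  rw [eq_tensor_iff]
  filter_upwards [unimodularMul_ae (hu.coord l) (tensor n f), tensor_ae f,
    (quasiMeasurePreserving_coord l).ae (unimodularMul_ae hu (f l))] with x h1 h2 h3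
  rw [h1, h2, prod_update_apply, h3, mul_assoc,
    Finset.mul_prod_erase Finset.univ (fun m => f m (x m)) (Finset.mem_univ l)]

/-- The coordinate `z_l` is itself unimodular, so the shifts and the multiplications by `Θ_l(z_l)`
fall under the same lemmas. -/
theorem coordMulL2_eq_unimodularMul (l : Fin n) (f : L2Torus n) :
    coordMulL2 l f = unimodularMul ((isUnimodular_fourier 1).coord l) f := by
  rw [eq_unimodularMul_iff]
  simpa only [fourier_one] using coordMulL2_ae l f

theorem coordMulL2_tensor (l : Fin n) (f : Fin n → L2Circle) :
    coordMulL2 l (tensor n f) = tensor n (Function.update f l (circleShift 1 (f l))) := by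
  rw [coordMulL2_eq_unimodularMul, unimodularMul_tensor]
  rfl

theorem toLp_mFourier_eq_tensor (k : Fin n → ℤ) :
    ContinuousMap.toLp 2 (torusMeasure n) ℂ (UnitAddTorus.mFourier k) =
      tensor n fun l => circleMonomial (k l) := by
  rw [eq_tensor_iff]
  have h : ∀ᵐ x ∂torusMeasure n, ∀ l, circleMonomial (k l) (x l) = fourier (k l) (x l) :=
    ae_all_iff.2 fun l => (quasiMeasurePreserving_coord l).ae (circleMonomial_ae (k l))
  filter_upwards [ContinuousMap.coeFn_toLp (p := 2) (𝕜 := ℂ) (torusMeasure n)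
    (UnitAddTorus.mFourier k), h] with x h1 h2
  rw [h1, UnitAddTorus.mFourier]
  simp only [ContinuousMap.coe_mk, h2]

theorem monomialL2_eq_tensor (k : Fin n → ℕ) :
    monomialL2 k = tensor n fun l => circleMonomial (k l) :=
  toLp_mFourier_eq_tensor _

/-- A Fourier mode with a negative exponent in some variable `l` is orthogonal to the tensor,
because the `l`-th factor of the inner product already vanishes. -/
theorem tensor_mem_hardySpace {f : Fin n → L2Circle} (hf : ∀ l, f l ∈ hardyCircle) :
    tensor n f ∈ hardySpace n := by
  let b : HilbertBasis (Fin n → ℤ) ℂ (L2Torus n) := UnitAddTorus.mFourierBasis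
  have hb : ∀ k, b k = tensor n fun l => circleMonomial (k l) := fun k =>
    (congrFun UnitAddTorus.coe_mFourierBasis k).trans (toLp_mFourier_eq_tensor k)
  have h := mem_closure_span_of_inner_eq_zero b {k | ∀ l, 0 ≤ k l} (tensor n f) fun k hk => by
    obtain ⟨l, hl⟩ := not_forall.1 hk
    rw [hb]
    exact inner_tensor_eq_zero _ _ l
      (inner_circleMonomial_of_mem_hardyCircle (hf l) (not_le.1 hl))
  refine Submodule.topologicalClosure_mono (Submodule.span_mono ?_) h
  rintro _ ⟨k, hk, rfl⟩
  refine ⟨fun l => (k l).toNat, ?_⟩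
  rw [hb, monomialL2_eq_tensor]
  simp only [Int.toNat_of_nonneg (hk _)]

theorem hardySpace_le {F : Submodule ℂ (L2Torus n)} (hF : IsClosed (F : Set (L2Torus n)))
    (h : ∀ k : Fin n → ℕ, tensor n (fun l => circleMonomial (k l)) ∈ F) : hardySpace n ≤ F :=
  Submodule.topologicalClosure_minimal _
    (Submodule.span_le.2 (by rintro _ ⟨k, rfl⟩; rw [monomialL2_eq_tensor]; exact h k)) hF

/-- If a tensor is orthogonal in the `l`-th variable to `u zᵏ`, `k ≥ 0`, then it is orthogonal to
`u(z_l) H²`. -/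
theorem inner_tensor_unimodularMul {u : UnitAddCircle → ℂ}
    (hu : IsUnimodular u AddCircle.haarAddCircle) (l : Fin n) (f : Fin n → L2Circle)
    (hf : ∀ k : ℕ, inner ℂ (f l) (unimodularMul hu (circleMonomial k)) = 0)
    {h : L2Torus n} (hh : h ∈ hardySpace n) :
    inner ℂ (tensor n f) (unimodularMul (hu.coord l) h) = 0 := by
  have : hardySpace n ≤ (ℂ ∙ tensor n f)ᗮ.comap
      (unimodularMul (hu.coord (n := n) l)).toContinuousLinearMap.toLinearMap := by
    refine hardySpace_le ((Submodule.isClosed_orthogonal _).preimage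
      (unimodularMul (hu.coord l)).continuous) fun k => ?_
    rw [Submodule.mem_comap, Submodule.mem_orthogonal_singleton_iff_inner_right]
    change inner ℂ _ (unimodularMul (hu.coord l) _) = 0
    rw [unimodularMul_tensor]
    refine inner_tensor_eq_zero _ _ l ?_
    rw [Function.update_self]
    exact hf (k l)
  exact Submodule.mem_orthogonal_singleton_iff_inner_right.1 (this hh)

end Tensor

/-! ### Model spaces in one variable -/

section Model

variable {θ : ℂ → ℂ} (hθ : IsInner θ)

/-- Multiplication by the boundary function of an inner function. -/
def IsInner.mul : L2Circle →ₗᵢ[ℂ] L2Circle := unimodularMul hθ.isUnimodular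

theorem IsInner.mul_circleMonomial (k : ℤ) :
    hθ.mul (circleMonomial k) = circleShift k hθ.boundary := by
  rw [IsInner.boundary, circleShift, unimodularMul_comm, ← circleShift, circleShift_circleMonomial,
    add_zero, IsInner.mul]

theorem IsInner.mul_circleMonomial_mem (k : ℕ) :
    hθ.mul (circleMonomial k) ∈ hardyCircle := by
  refine mem_hardyCircle_of_inner_eq_zero _ fun l hl => ?_
  rw [hθ.mul_circleMonomial, ← inner_conj_symm, inner_circleShift_left, inner_conj_symm,
    circleShift_circleMonomial]
  exact hθ.inner_boundary _ (by lia)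

/-- The submodule `θ H²` of `H²(𝔻)`. -/
def IsInner.range : Submodule ℂ L2Circle := hardyCircle.map hθ.mul.toLinearMap

theorem IsInner.isClosed_range : IsClosed (hθ.range : Set L2Circle) := by
  rw [IsInner.range, Submodule.map_coe]
  exact hθ.mul.isometry.isClosedEmbedding.isClosedMap _ isClosed_hardyCircle

theorem IsInner.range_le : hθ.range ≤ hardyCircle := by
  rw [IsInner.range, Submodule.map_le_iff_le_comap]
  exact hardyCircle_le (isClosed_hardyCircle.preimage hθ.mul.continuous) hθ.mul_circleMonomial_mem

/-- The quotient module `H² ⊖ θ H²`. -/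
def IsInner.model : Submodule ℂ L2Circle := hardyCircle ⊓ hθ.rangeᗮ

theorem IsInner.exists_add_of_mem_hardyCircle {f : L2Circle} (hf : f ∈ hardyCircle) :
    ∃ q ∈ hθ.model, ∃ h ∈ hardyCircle, f = q + hθ.mul h := by
  have : CompleteSpace hθ.range := hθ.isClosed_range.completeSpace_coe
  obtain ⟨s, hs, q, hq, e⟩ := hθ.range.exists_add_mem_mem_orthogonal f
  refine ⟨q, ⟨?_, hq⟩, ?_⟩
  · rw [eq_sub_of_add_eq' e.symm]
    exact Submodule.sub_mem _ hf (hθ.range_le hs)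
  · obtain ⟨h, hh, rfl⟩ := hs
    exact ⟨h, hh, e.trans (add_comm _ _)⟩

theorem IsInner.inner_model_mul {q h : L2Circle} (hq : q ∈ hθ.model) (hh : h ∈ hardyCircle) :
    inner ℂ q (hθ.mul h) = 0 :=
  (Submodule.mem_orthogonal' _ _).1 hq.2 _ ⟨h, hh, rfl⟩

/-- The constant term of an inner function. -/
def IsInner.constCoeff : ℂ := inner ℂ (circleMonomial 0) hθ.boundary

/-- `θ - θ(0)`. -/
def IsInner.sub : L2Circle := hθ.boundary - hθ.constCoeff • circleMonomial 0

/-- The backward shift `(θ - θ(0)) / z` of an inner function. -/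
def IsInner.backward : L2Circle := circleShift (-1) hθ.sub

theorem IsInner.shift_backward : circleShift 1 hθ.backward = hθ.sub := by
  rw [IsInner.backward, circleShift_circleShift, add_neg_cancel, circleShift_zero]

theorem IsInner.boundary_mem_hardyCircle : hθ.boundary ∈ hardyCircle :=
  hθ.mul_circleMonomial_mem 0

theorem IsInner.inner_one_sub : inner ℂ (circleMonomial 0) hθ.sub = 0 := by
  rw [IsInner.sub, inner_sub_right, inner_smul_right, inner_circleMonomial, if_pos rfl, mul_one,
    IsInner.constCoeff, sub_self]

/-- `θ` is the sum of `θ - θ(0)` and a constant orthogonal to it, and the shift is isometric. These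
scalars make up the constant of the final computation. -/
theorem IsInner.inner_boundary_sub : inner ℂ hθ.boundary hθ.sub = (‖hθ.backward‖ : ℂ) ^ 2 := by
  have h : hθ.boundary = hθ.sub + hθ.constCoeff • circleMonomial 0 := (sub_add_cancel _ _).symm
  rw [h, inner_add_left, inner_smul_left, hθ.inner_one_sub, mul_zero, add_zero,
    inner_self_eq_norm_sq_to_K, IsInner.backward, LinearIsometry.norm_map]
  rfl

theorem IsInner.inner_sub_boundary : inner ℂ hθ.sub hθ.boundary = (‖hθ.backward‖ : ℂ) ^ 2 := by
  rw [← inner_conj_symm, hθ.inner_boundary_sub, ← Complex.ofReal_pow, Complex.conj_ofReal]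

/-- Removing the constant term makes division by `z` stay in `H²`. Orthogonality to `θ zᵏ` amounts
to `⟨θ - θ(0), θ zᵏ⁺¹⟩ = 0`: unimodularity reduces `⟨θ, θ zᵏ⁺¹⟩` to `⟨1, zᵏ⁺¹⟩`, and `θ zᵏ⁺¹` has no
constant term. -/
theorem IsInner.backward_mem_model : hθ.backward ∈ hθ.model := by
  constructor
  · refine mem_hardyCircle_of_inner_eq_zero _ fun k hk => ?_
    rw [IsInner.backward, ← inner_conj_symm, inner_circleShift_left, inner_conj_symm, neg_neg,
      circleShift_circleMonomial]
    -- Only `k = -1` meets the constant coefficient, which was subtracted; for smaller `k` both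
    -- terms have zero coefficient.
    rcases (show 1 + k < 0 ∨ 1 + k = 0 by lia) with h | h
    · rw [IsInner.sub, inner_sub_right, inner_smul_right, hθ.inner_boundary _ h,
        inner_circleMonomial, if_neg h.ne, mul_zero, sub_zero]
    · rw [h, hθ.inner_one_sub]
  · have : hardyCircle ≤ (ℂ ∙ hθ.backward)ᗮ.comap hθ.mul.toLinearMap := by
      refine hardyCircle_le ((Submodule.isClosed_orthogonal _).preimage hθ.mul.continuous)
        fun k => ?_
      rw [Submodule.mem_comap, Submodule.mem_orthogonal_singleton_iff_inner_right]
      change inner ℂ _ (hθ.mul _) = 0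
      rw [IsInner.backward, inner_circleShift_left, neg_neg, IsInner.sub, inner_sub_left,
        inner_smul_left]
      have h1 : circleShift 1 (hθ.mul (circleMonomial k)) = hθ.mul (circleMonomial ((k : ℤ) + 1)) := by
        rw [hθ.mul_circleMonomial, circleShift_circleShift, hθ.mul_circleMonomial, add_comm]
      have h2 : inner ℂ hθ.boundary (hθ.mul (circleMonomial ((k : ℤ) + 1))) = 0 := by
        change inner ℂ (hθ.mul _) _ = 0
        rw [hθ.mul.inner_map_map, inner_circleMonomial, if_neg (by lia)]
      rw [h1, h2, hθ.mul_circleMonomial, ← inner_conj_symm, inner_circleShift_left, inner_conj_symm,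
        circleShift_circleMonomial, hθ.inner_boundary _ (by lia), mul_zero, sub_zero]
    refine (Submodule.mem_orthogonal' _ _).2 ?_
    rintro _ ⟨h, hh, rfl⟩
    exact Submodule.mem_orthogonal_singleton_iff_inner_right.1 (this hh)

/-- An inner function whose backward shift vanishes is a constant of modulus one. -/
theorem IsInner.ae_const_of_backward_eq_zero (h : hθ.backward = 0) :
    hθ.constCoeff ≠ 0 ∧
      ∀ᵐ x : UnitAddCircle ∂AddCircle.haarAddCircle, radialLimit θ x = hθ.constCoeff := by
  have h0 : hθ.boundary = hθ.constCoeff • circleMonomial 0 := by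
    rw [← sub_eq_zero]
    change hθ.sub = 0
    rw [← hθ.shift_backward, h, map_zero]
  have h1 : ‖hθ.boundary‖ = 1 := by
    rw [IsInner.boundary, LinearIsometry.norm_map]
    exact orthonormal_fourier.1 0
  constructor
  · intro hc
    rw [h0, hc, zero_smul, norm_zero] at h1
    exact zero_ne_one h1
  · filter_upwards [unimodularMul_ae hθ.isUnimodular (circleMonomial 0), circleMonomial_ae 0,
      Lp.coeFn_smul hθ.constCoeff (circleMonomial 0)] with x a b c
    have e : hθ.boundary x = (hθ.constCoeff • circleMonomial 0 : L2Circle) x := by rw [← h0]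
    rw [IsInner.boundary, a, c, Pi.smul_apply, b, fourier_zero, smul_eq_mul, mul_one,
      mul_one] at e
    exact e

end Model

/-! ### Inner multipliers in one variable of the polydisc and the submodule they generate -/

variable {n : ℕ} {Θ : Fin n → ℂ → ℂ}

/-- Multiplication by `Θ_l(z_l)` on `L²(𝕋ⁿ)`. -/
def IsInner.coordMul {θ : ℂ → ℂ} (hθ : IsInner θ) (l : Fin n) : L2Torus n →ₗᵢ[ℂ] L2Torus n :=
  unimodularMul (hθ.isUnimodular.coord l)

theorem IsInner.mem_multiplierRange_iff {θ : ℂ → ℂ} (hθ : IsInner θ) (l : Fin n) (f : H2 n) :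
    f ∈ multiplierRange (fun z : Fin n → ℂ => θ (z l)) ↔
      ∃ g : H2 n, (f : L2Torus n) = hθ.coordMul l g :=
  exists_congr fun _ => (eq_unimodularMul_iff (hθ.isUnimodular.coord l) _ _).symm

theorem IsInner.coordMul_tensor {θ : ℂ → ℂ} (hθ : IsInner θ) (l : Fin n)
    (f : Fin n → L2Circle) :
    hθ.coordMul l (tensor n f) = tensor n (Function.update f l (hθ.mul (f l))) :=
  unimodularMul_tensor hθ.isUnimodular l f

theorem IsInner.coordMul_coordMulL2 {θ : ℂ → ℂ} (hθ : IsInner θ) (l i : Fin n)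
    (f : L2Torus n) :
    hθ.coordMul l (coordMulL2 i f) = coordMulL2 i (hθ.coordMul l f) := by
  rw [coordMulL2_eq_unimodularMul, coordMulL2_eq_unimodularMul, IsInner.coordMul,
    unimodularMul_comm]

theorem IsInner.inner_tensor_coordMul {θ : ℂ → ℂ} (hθ : IsInner θ) (l : Fin n)
    {f : Fin n → L2Circle} (hf : f l ∈ hθ.model) {h : L2Torus n} (hh : h ∈ hardySpace n) :
    inner ℂ (tensor n f) (hθ.coordMul l h) = 0 :=
  inner_tensor_unimodularMul hθ.isUnimodular l f
    (fun k => hθ.inner_model_mul hf (circleMonomial_mem_hardyCircle k)) hh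

theorem IsInner.isClosed_model {θ : ℂ → ℂ} (hθ : IsInner θ) :
    IsClosed (hθ.model : Set L2Circle) :=
  isClosed_hardyCircle.inter (Submodule.isClosed_orthogonal _)

instance {θ : ℂ → ℂ} (hθ : IsInner θ) : CompleteSpace hθ.model :=
  hθ.isClosed_model.completeSpace_coe

/-- If `Θ_l` is constant then `Θ_l H²` is everything. -/
theorem IsInner.multiplierRange_eq_top {θ : ℂ → ℂ} (hθ : IsInner θ) (l : Fin n)
    (h : hθ.backward = 0) : multiplierRange (fun z : Fin n → ℂ => θ (z l)) = ⊤ := by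
  obtain ⟨hc, hae⟩ := hθ.ae_const_of_backward_eq_zero h
  refine Submodule.eq_top_iff'.2 fun f => ⟨hθ.constCoeff⁻¹ • f, ?_⟩
  filter_upwards [(quasiMeasurePreserving_coord l).ae hae,
    Lp.coeFn_smul hθ.constCoeff⁻¹ (f : L2Torus n)] with x h1 h2
  have h3 : boundaryValue (fun z : Fin n → ℂ => θ (z l)) x = hθ.constCoeff := h1
  rw [h3, Submodule.coe_smul, h2, Pi.smul_apply, smul_eq_mul, mul_inv_cancel_left₀ hc]

variable (hΘ : ∀ l, IsInner (Θ l)) {S : HilbertSubmodule (coordMul n)}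
  (hS : S.toSubmodule = ⨆ l : Fin n, multiplierRange fun z : Fin n → ℂ => Θ l (z l))

include hS in
theorem tensor_mem_submodule {f : Fin n → L2Circle} (hf : ∀ l, f l ∈ hardyCircle) (l : Fin n)
    {h : L2Circle} (hh : h ∈ hardyCircle) (hl : f l = (hΘ l).mul h) :
    (⟨tensor n f, tensor_mem_hardySpace hf⟩ : H2 n) ∈ S.toSubmodule := by
  rw [hS]
  refine Submodule.mem_iSup_of_mem l (((hΘ l).mem_multiplierRange_iff l _).2 ?_)
  refine ⟨⟨tensor n (Function.update f l h), tensor_mem_hardySpace fun m => ?_⟩, ?_⟩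
  · by_cases e : m = l
    · subst e; rwa [Function.update_self]
    · rw [Function.update_of_ne e]; exact hf m
  · rw [IsInner.coordMul_tensor, Function.update_self, Function.update_idem, ← hl,
      Function.update_eq_self]

include hS in
-- `S` is the algebraic sum of the spaces `Θ_l(z_l) H²`, so a linear condition need only be tested
-- on each of them. In the application `A` is a coordinate shift.
theorem inner_submodule_eq_zero {p : L2Torus n} (A : L2Torus n →L[ℂ] L2Torus n)
    (hp : ∀ l, ∀ h ∈ hardySpace n, inner ℂ p (A ((hΘ l).coordMul l h)) = 0) {s : H2 n}
    (hs : s ∈ S.toSubmodule) : inner ℂ p (A s) = 0 := by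
  have : S.toSubmodule ≤
      ((ℂ ∙ p)ᗮ.comap A.toLinearMap).comap (hardySpace n).subtype := by
    rw [hS]
    refine iSup_le fun l f hf => ?_
    obtain ⟨g, hg⟩ := ((hΘ l).mem_multiplierRange_iff l f).1 hf
    rw [Submodule.mem_comap, Submodule.mem_comap,
      Submodule.mem_orthogonal_singleton_iff_inner_right]
    change inner ℂ p (A f) = 0
    rw [hg]
    exact hp l g g.2
  exact Submodule.mem_orthogonal_singleton_iff_inner_right.1 (this hs)

/-! ### Finite codimension from finite-dimensional model spaces -/

/-- The tensor product of the model spaces, mapped to `H²(𝔻ⁿ)`. -/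
def modelTensor : MultilinearMap ℂ (fun l => (hΘ l).model) (H2 n) :=
  ((tensor n).compLinearMap fun l => (hΘ l).model.subtype).codRestrict (hardySpace n)
    fun q => tensor_mem_hardySpace fun l => (q l).2.1

-- The set `s` holds the variables whose factor need not lie in the model space. Splitting one such
-- factor as `q + Θ_a h` gives a term in `S`, to which `x` is orthogonal, and a term with one
-- exceptional variable fewer.
include hS in
theorem inner_tensor_eq_zero_of_orthogonal {x : H2 n} (hx : x ∈ (S.toSubmodule)ᗮ)
    (hq : ∀ q : (l : Fin n) → (hΘ l).model, inner ℂ x (modelTensor hΘ q) = 0)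
    (s : Finset (Fin n)) (g : Fin n → L2Circle) (hg : ∀ l, g l ∈ hardyCircle)
    (hs : ∀ l ∉ s, g l ∈ (hΘ l).model) : inner ℂ (x : L2Torus n) (tensor n g) = 0 := by
  induction s using Finset.induction_on generalizing g with
  | empty => exact hq fun l => ⟨g l, hs l (Finset.notMem_empty l)⟩
  | insert a s ha ih =>
    obtain ⟨q, hq, h, hh, e⟩ := (hΘ a).exists_add_of_mem_hardyCircle (hg a)
    have hu : ∀ v ∈ hardyCircle, ∀ l, Function.update g a v l ∈ hardyCircle := by
      intro v hv l
      by_cases hl : l = a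
      · subst hl; rwa [Function.update_self]
      · rw [Function.update_of_ne hl]; exact hg l
    have hm : (hΘ a).mul h ∈ hardyCircle := (hΘ a).range_le ⟨h, hh, rfl⟩
    rw [← Function.update_eq_self a g, e, (tensor n).map_update_add, inner_add_right,
      ih _ (hu q hq.1), zero_add]
    · exact (Submodule.mem_orthogonal' _ _).1 hx _
        (tensor_mem_submodule hΘ hS (hu _ hm) a hh (Function.update_self ..))
    · intro l hl
      by_cases hla : l = a
      · subst hla; rwa [Function.update_self]
      · rw [Function.update_of_ne hla]
        exact hs l (by simp [hla, hl])

-- The monomials span a dense subspace of `H²(𝔻ⁿ)`, so a vector orthogonal to `S` and to all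
-- products of model functions is zero. Hence `Sᗮ` embeds in the span of these products by
-- orthogonal projection.
include hS in
theorem finiteDimensional_quotient (hfin : ∀ l, FiniteDimensional ℂ (hΘ l).model) :
    FiniteDimensional ℂ (H2 n ⧸ S.toSubmodule) := by
  -- As the image of a tensor product of finite-dimensional spaces, `T` is visibly
  -- finite-dimensional.
  let T : Submodule ℂ (H2 n) := LinearMap.range (PiTensorProduct.lift (modelTensor hΘ))
  have hT : ∀ q, modelTensor hΘ q ∈ T := fun q =>
    ⟨PiTensorProduct.tprod ℂ q, PiTensorProduct.lift.tprod q⟩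
  have : FiniteDimensional ℂ T := inferInstance
  have key : ∀ x ∈ (S.toSubmodule)ᗮ, x ∈ Tᗮ → x = 0 := by
    intro x hx hxT
    have h1 : hardySpace n ≤ (ℂ ∙ (x : L2Torus n))ᗮ := by
      refine hardySpace_le (Submodule.isClosed_orthogonal _) fun k => ?_
      rw [Submodule.mem_orthogonal_singleton_iff_inner_right]
      exact inner_tensor_eq_zero_of_orthogonal hΘ hS hx
        (fun q => (Submodule.mem_orthogonal' _ _).1 hxT _ (hT q)) Finset.univ _
        (fun l => circleMonomial_mem_hardyCircle (k l)) fun l hl => absurd (Finset.mem_univ l) hl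
    have h2 := Submodule.mem_orthogonal_singleton_iff_inner_right.1 (h1 x.2)
    exact Subtype.ext (inner_self_eq_zero.1 h2)
  let P : (S.toSubmodule)ᗮ →ₗ[ℂ] T :=
    T.orthogonalProjectionOnto.toLinearMap ∘ₗ (S.toSubmodule)ᗮ.subtype
  have hP : Function.Injective P := by
    rw [injective_iff_map_eq_zero]
    intro x hx
    refine Subtype.ext (key x x.2 ?_)
    exact Submodule.orthogonalProjectionOnto_eq_zero_iff.1 hx
  have : FiniteDimensional ℂ (S.toSubmodule)ᗮ := FiniteDimensional.of_injective P hP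
  exact Module.Finite.equiv (Submodule.quotientEquivOfIsCompl _ _
    (Submodule.isCompl_orthogonal (K := S.toSubmodule))).symm

/-! ### Compact cross commutators -/

section Compact

variable {H E : Type*} [NormedAddCommGroup H] [InnerProductSpace ℂ H] [CompleteSpace H]
  [NormedAddCommGroup E] [InnerProductSpace ℂ E] [CompleteSpace E]

/-- Orthogonality of `x` to the range of `A` means `A* x = 0`, which kills the term `B A* x`. -/
theorem inner_crossCommutator (A B : H →L[ℂ] H) (x y : H) (hx : ∀ z, inner ℂ x (A z) = 0) :
    inner ℂ (crossCommutator A B x) y = inner ℂ (B x) (A y) := by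
  have h : ContinuousLinearMap.adjoint A x = 0 := by
    refine ext_inner_right ℂ fun z => ?_
    rw [ContinuousLinearMap.adjoint_inner_left, inner_zero_left, hx]
  rw [crossCommutator, sub_apply, ContinuousLinearMap.comp_apply,
    ContinuousLinearMap.comp_apply, h, map_zero, sub_zero, ContinuousLinearMap.adjoint_inner_left]

/-- A compact operator whose form restricts to a nonzero multiple of an inner product does so on a
finite-dimensional space only. -/
theorem finiteDimensional_of_isCompactOperator {K : H →L[ℂ] H} (hK : IsCompactOperator K)
    (J G : E →L[ℂ] H) {c : ℂ} (hc : c ≠ 0)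
    (h : ∀ q r, inner ℂ (K (J q)) (G r) = c * inner ℂ q r) : FiniteDimensional ℂ E := by
  -- The inner product is conjugate-linear in its first argument, hence the normalization by `conj
  -- c`.
  let A : E →L[ℂ] E := (conj c)⁻¹ • (ContinuousLinearMap.adjoint G ∘L K ∘L J)
  have hA : A = ContinuousLinearMap.id ℂ E := by
    ext1 q
    refine ext_inner_right ℂ fun r => ?_
    change inner ℂ ((conj c)⁻¹ • (ContinuousLinearMap.adjoint G (K (J q)))) r = inner ℂ q r
    rw [inner_smul_left, ContinuousLinearMap.adjoint_inner_left, h, map_inv₀, Complex.conj_conj,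
      inv_mul_cancel_left₀ hc]
  have hcomp : IsCompactOperator A :=
    ((hK.comp_clm J).clm_comp (ContinuousLinearMap.adjoint G)).smul (conj c)⁻¹
  rw [hA] at hcomp
  exact isCompactOperator_id_iff_finiteDimensional.1 hcomp

/-- A submodule with a compact cross commutator, tested on two families of vectors. -/
theorem HilbertSubmodule.finiteDimensional_of_isCompactOperator {T : Fin n → H →L[ℂ] H}
    (S : HilbertSubmodule T) {i j : Fin n}
    (hK : IsCompactOperator
      (crossCommutator (H := S.toSubmodule) (S.restriction i) (S.restriction j)))
    (J G : E →L[ℂ] H) (hJ : ∀ q, J q ∈ S.toSubmodule) (hG : ∀ q, G q ∈ S.toSubmodule)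
    (h0 : ∀ q, ∀ s ∈ S.toSubmodule, inner ℂ (J q) (T i s) = 0) {c : ℂ} (hc : c ≠ 0)
    (h : ∀ q r, inner ℂ (T j (J q)) (T i (G r)) = c * inner ℂ q r) :
    FiniteDimensional ℂ E := by
  refine HardyPolydisc.finiteDimensional_of_isCompactOperator hK
    (J.codRestrict S.toSubmodule hJ) (G.codRestrict S.toSubmodule hG) hc fun q r => ?_
  rw [inner_crossCommutator (S.restriction i) (S.restriction j) _ _ fun z => h0 q z z.2]
  exact h q r

end Compact

/-! ### Test vectors for the cross commutators -/

/-- The factors of the tensor with the boundary function in the variable `m` and backward shifts elsewhere. -/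
def testFunction (m : Fin n) (l : Fin n) : L2Circle :=
  if l = m then (hΘ l).boundary else (hΘ l).backward

theorem testFunction_self (m : Fin n) : testFunction hΘ m m = (hΘ m).boundary := if_pos rfl

theorem testFunction_of_ne {m l : Fin n} (h : l ≠ m) : testFunction hΘ m l = (hΘ l).backward :=
  if_neg h

theorem update_testFunction_mem_hardyCircle (m k : Fin n) (q : (hΘ k).model) (l : Fin n) :
    Function.update (testFunction hΘ m) k (q : L2Circle) l ∈ hardyCircle := by
  by_cases hl : l = k
  · subst hl; rw [Function.update_self]; exact q.2.1
  · rw [Function.update_of_ne hl]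
    by_cases hm : l = m
    · subst hm; rw [testFunction_self]; exact (hΘ l).boundary_mem_hardyCircle
    · rw [testFunction_of_ne hΘ hm]; exact (hΘ l).backward_mem_model.1

/-- Insertion of an element of the `k`-th model space in a test function. -/
def testMap (m k : Fin n) : (hΘ k).model →L[ℂ] H2 n :=
  LinearMap.mkContinuous
    { toFun := fun q => ⟨tensor n (Function.update (testFunction hΘ m) k (q : L2Circle)),
        tensor_mem_hardySpace (update_testFunction_mem_hardyCircle hΘ m k q)⟩
      map_add' := fun q r => Subtype.ext ((tensor n).map_update_add _ _ _ _)
      map_smul' := fun c q => Subtype.ext ((tensor n).map_update_smul _ _ _ _) }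
    (∏ l ∈ Finset.univ.erase k, ‖testFunction hΘ m l‖) fun q => by
      change ‖tensor n (Function.update (testFunction hΘ m) k (q : L2Circle))‖ ≤ _ * ‖q‖
      rw [norm_tensor, ← Finset.mul_prod_erase _ _ (Finset.mem_univ k), Function.update_self,
        mul_comm]
      refine le_of_eq ?_
      congr 1
      refine Finset.prod_congr rfl fun l hl => ?_
      rw [Function.update_of_ne (Finset.ne_of_mem_erase hl)]

include hS in
theorem testMap_mem {m k : Fin n} (hmk : k ≠ m) (q : (hΘ k).model) :
    testMap hΘ m k q ∈ S.toSubmodule :=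
  tensor_mem_submodule hΘ hS (update_testFunction_mem_hardyCircle hΘ m k q) m
    (circleMonomial_mem_hardyCircle 0)
    (by rw [Function.update_of_ne hmk.symm, testFunction_self]; rfl)

-- On the summand `l = m` the common factor `Θ_m` cancels, leaving the constant `1` against a
-- multiple of `z_m`. On every other summand the `l`-th factor of the test vector lies in the model
-- space of `Θ_l`, and `z_m` commutes past `Θ_l`.
include hS in
theorem inner_testMap_coordMul {m k : Fin n} (hmk : k ≠ m) (q : (hΘ k).model) {s : H2 n}
    (hs : s ∈ S.toSubmodule) : inner ℂ (testMap hΘ m k q) (coordMul n m s) = 0 := by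
  change inner ℂ (tensor n (Function.update (testFunction hΘ m) k (q : L2Circle)))
    (coordMulL2 m s) = 0
  refine inner_submodule_eq_zero hΘ hS (coordMulL2 m) (fun l h hh => ?_) hs
  rw [← IsInner.coordMul_coordMulL2]
  by_cases hl : l = m
  · subst hl
    have e : tensor n (Function.update (testFunction hΘ l) k (q : L2Circle)) =
        (hΘ l).coordMul l (tensor n (Function.update
          (Function.update (testFunction hΘ l) k (q : L2Circle)) l (circleMonomial 0))) := by
      rw [IsInner.coordMul_tensor, Function.update_self, Function.update_idem]
      congr 1
      symm
      rw [Function.update_eq_self_iff, Function.update_of_ne hmk.symm, testFunction_self]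
      rfl
    rw [e, LinearIsometry.inner_map_map, coordMulL2_eq_unimodularMul]
    refine inner_tensor_unimodularMul (isUnimodular_fourier 1) l _ (fun j => ?_) hh
    rw [Function.update_self]
    change inner ℂ _ (circleShift 1 _) = 0
    rw [circleShift_circleMonomial, inner_circleMonomial, if_neg (by lia)]
  · refine (hΘ l).inner_tensor_coordMul l ?_ (coordMulL2_mem m h hh)
    by_cases hk : l = k
    · subst hk; rw [Function.update_self]; exact q.2
    · rw [Function.update_of_ne hk, testFunction_of_ne hΘ hl]
      exact (hΘ l).backward_mem_model

/-- The shift by `z_j` turns the backward shift in the variable `j` into `Θ_j - Θ_j(0)`, paired with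
`Θ_j`; the variable `i` is symmetric. Every variable `l ≠ k` therefore contributes `‖B_l‖²`. -/
theorem exists_inner_coordMul_testMap (hb : ∀ l, (hΘ l).backward ≠ 0) {i j k : Fin n}
    (hij : i ≠ j) (hki : k ≠ i) (hkj : k ≠ j) :
    ∃ c : ℂ, c ≠ 0 ∧ ∀ q r : (hΘ k).model,
      inner ℂ (coordMul n j (testMap hΘ i k q)) (coordMul n i (testMap hΘ j k r)) =
        c * inner ℂ q r := by
  refine ⟨∏ l ∈ Finset.univ.erase k,
    inner ℂ (Function.update (testFunction hΘ i) j (hΘ j).sub l)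
      (Function.update (testFunction hΘ j) i (hΘ i).sub l), ?_, fun q r => ?_⟩
  · refine Finset.prod_ne_zero_iff.2 fun l _ => ?_
    have hl : ((‖(hΘ l).backward‖ : ℂ)) ^ 2 ≠ 0 :=
      pow_ne_zero _ (by exact_mod_cast norm_ne_zero_iff.2 (hb l))
    by_cases h1 : l = i
    · subst h1
      rwa [Function.update_self, Function.update_of_ne hij, testFunction_self,
        IsInner.inner_boundary_sub]
    by_cases h2 : l = j
    · subst h2
      rwa [Function.update_self, Function.update_of_ne h1, testFunction_self,
        IsInner.inner_sub_boundary]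
    · rw [Function.update_of_ne h1, Function.update_of_ne h2, testFunction_of_ne hΘ h1,
        testFunction_of_ne hΘ h2]
      exact inner_self_ne_zero.2 (hb l)
  · change inner ℂ (coordMulL2 j (tensor n _)) (coordMulL2 i (tensor n _)) = _
    rw [coordMulL2_tensor, coordMulL2_tensor, Function.update_of_ne hkj.symm,
      Function.update_of_ne hki.symm, testFunction_of_ne hΘ hij, testFunction_of_ne hΘ hij.symm,
      IsInner.shift_backward, IsInner.shift_backward, Function.update_comm hkj,
      Function.update_comm hki, inner_tensor, ← Finset.mul_prod_erase _ _ (Finset.mem_univ k),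
      Function.update_self, Function.update_self, mul_comm]
    congr 1
    refine Finset.prod_congr rfl fun l hl => ?_
    rw [Function.update_of_ne (Finset.ne_of_mem_erase hl),
      Function.update_of_ne (Finset.ne_of_mem_erase hl)]

include hS in
theorem finiteDimensional_model (hb : ∀ l, (hΘ l).backward ≠ 0) {i j k : Fin n}
    (hij : i ≠ j) (hki : k ≠ i) (hkj : k ≠ j)
    (hK : IsCompactOperator
      (crossCommutator (H := S.toSubmodule) (S.restriction i) (S.restriction j))) :
    FiniteDimensional ℂ (hΘ k).model := by
  obtain ⟨c, hc, h⟩ := exists_inner_coordMul_testMap hΘ hb hij hki hkj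
  exact S.finiteDimensional_of_isCompactOperator hK (testMap hΘ i k) (testMap hΘ j k)
    (testMap_mem hΘ hS hki) (testMap_mem hΘ hS hkj)
    (fun q _ hs => inner_testMap_coordMul hΘ hS hki q hs) hc h

include hΘ hS in
/-- An essentially doubly commuting submodule `∑ Θ_l(z_l) H²` of infinite codimension lives on the
bidisc. -/
theorem eq_two_of_isEssentiallyDoublyCommuting (hn : 2 ≤ n)
    (hinf : ¬ FiniteDimensional ℂ (H2 n ⧸ S.toSubmodule))
    (h : S.IsEssentiallyDoublyCommuting) : n = 2 := by
  by_contra hn2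
  have hb : ∀ l, (hΘ l).backward ≠ 0 := by
    intro l hl
    apply hinf
    have htop : S.toSubmodule = ⊤ := by
      rw [hS, eq_top_iff, ← (hΘ l).multiplierRange_eq_top l hl]
      exact le_iSup (fun l : Fin n => multiplierRange fun z : Fin n → ℂ => Θ l (z l)) l
    have := Submodule.Quotient.subsingleton_iff.2 htop
    infer_instance
  refine hinf (finiteDimensional_quotient hΘ hS fun k => ?_)
  -- Since `n ≥ 3`, two of the first three indices avoid `k`. They are taken in increasing order
  -- because compactness is only assumed for `i < j`.
  obtain ⟨i, j, hij, hki, hkj⟩ : ∃ i j : Fin n, i < j ∧ k ≠ i ∧ k ≠ j := by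
    rcases (show k.val = 0 ∨ k.val = 1 ∨ 2 ≤ k.val by lia) with h | h | h
    · exact ⟨⟨1, by lia⟩, ⟨2, by lia⟩, by simp, by simp [Fin.ext_iff, h], by simp [Fin.ext_iff, h]⟩
    · exact ⟨⟨0, by lia⟩, ⟨2, by lia⟩, by simp, by simp [Fin.ext_iff, h], by simp [Fin.ext_iff, h]⟩
    · exact ⟨⟨0, by lia⟩, ⟨1, by lia⟩, by simp, by simp [Fin.ext_iff]; lia,
        by simp [Fin.ext_iff]; lia⟩
  exact finiteDimensional_model hΘ hS hb hij.ne hki hkj (h i j hij)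

end HardyPolydisc

end

theorem corollary2p8 (n : ℕ) (hn : 2 ≤ n)
    (Θ : Fin n → ℂ → ℂ) (hΘ : ∀ i, HardyPolydisc.IsInner (Θ i))
    (S : HardyPolydisc.HilbertSubmodule (HardyPolydisc.coordMul n))
    (hS : S.toSubmodule =
      ⨆ i : Fin n, HardyPolydisc.multiplierRange fun z : Fin n → ℂ => Θ i (z i))
    (hco : S.IsCoDoublyCommuting)
    (hinf : ¬ FiniteDimensional ℂ (HardyPolydisc.H2 n ⧸ S.toSubmodule)) :
    (S.IsEssentiallyDoublyCommuting → n = 2) ∧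
      (S.IsEssentiallyNormal → n = 2) :=
  ⟨fun h => HardyPolydisc.eq_two_of_isEssentiallyDoublyCommuting hΘ hS hn hinf h,
    fun h => HardyPolydisc.eq_two_of_isEssentiallyDoublyCommuting hΘ hS hn hinf
      fun i j _ => h i j⟩
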